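/- Let $\mathrm{GF}(q)\subseteq \mathrm{GF}(q^m)$ be finite fields, let $N=q^m-1$, and let $\{\beta_1,\dots,\beta_m\}$ be a basis of $\mathrm{GF}(q^m)$ over $\mathrm{GF}(q)$. For $x\in\mathrm{GF}(q^m)$ write $x=\sum_{j=1}^m\mu_j(x)\beta_j$ with $\mu_j(x)\in\mathrm{GF}(q)$. For a finite family $\Gamma$ of nonzero elements of $\mathrm{GF}(q^m)$ let ${\bf G}_e(\Gamma)$ be the expanded generator matrix: it has a row for each pair $(\gamma,i)$ with $\gamma$ in $\Gamma$ and $1\le i\le m$, namely the vector $\beta_i\,[1,\gamma,\gamma^2,\dots,\gamma^{N-1}]$ with each entry $x$ replaced by $(\mu_1(x),\dots,\mu_m(x))$. The expanded code of $\Gamma$ is the row space of ${\bf G}_e(\Gamma)$ over $\mathrm{GF}(q)$, a linear code of length $mN$ over $\mathrm{GF}(q)$. A codeword is represented by the subbasis $\{\beta_j: j\in S\}$, $S\subseteq\{1,\dots,m\}$, if all its coordinates belonging to $\beta_j$ with $j\notin S$ vanish. For $\gamma\in\mathrm{GF}(q^m)$ let $\phi(\gamma)=\{\gamma,\gamma^q,\gamma^{q^2},\dots\}$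 be its conjugacy class and $p_\gamma(x)\in\mathrm{GF}(q)[x]$ its minimal polynomial over $\mathrm{GF}(q)$. The minimum distance of a code is the least Hamming distance between two distinct codewords, and $+\infty$ for a code with only one codeword. Theorem. Let $\gamma_1,\dots,\gamma_k$ be nonzero elements of $\mathrm{GF}(q^m)$. Then the minimum distance $d_{\min}$ of the expanded code with generator matrix ${\bf G}_e(\gamma_1,\dots,\gamma_k)$ satisfies $$d_{\min}\;\ge\;\min_{1\le i\le m}\{\,i\cdot d^{(i)}\,\},$$ where $d^{(i)}$ is the minimum distance of the cyclic code of length $N$ over $\mathrm{GF}(q)$ with generator polynomial $$G^{(i)}(x)=\frac{x^N-1}{\operatorname{LCM}\{p_{\gamma_l^{-1}}(x):\ l\in J_i\}}$$ and $J_i$ is the set of those $l\in\{1,\dots,k\}$ for which the expanded code of $\phi(\gamma_l)\cap\{\gamma_1,\dots,\gamma_k\}$ contains a nonzero codeword that is represented by a subbasis of at most $i$ elements. (The LCM of the empty set is $1$.) -/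

import Mathlib

open Polynomial

/-- The minimum distance of a code `C`: the least Hamming distance between two distinct
codewords, with the value `⊤` if there are no two distinct codewords. -/
noncomputable def minDist {ι K : Type*} [Fintype ι] (C : Set (ι → K)) : ℕ∞ :=
  open Classical in
  ⨅ (x ∈ C) (y ∈ C) (_ : x ≠ y), ((hammingDist x y : ℕ) : ℕ∞)

/-- The conjugacy class `{γ, γ^q, γ^(q^2), …}` of `γ` over `K = GF(q)`. -/
def conjClass (K : Type*) {L : Type*} [Fintype K] [Field L] (γ : L) : Set L :=
  Set.range fun s : ℕ => γ ^ (Fintype.card K ^ s)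

/-- The row vector `[1, γ, γ^2, …, γ^(N-1)]`. -/
def gVec {L : Type*} [Field L] (N : ℕ) (γ : L) : Fin N → L := fun t => γ ^ (t : ℕ)

/-- The expanded generator matrix of the family `γ` with respect to the basis `β`. The row
`(l, i)` is the vector `β_i • g(γ_l)`, every entry of which is replaced by its `m` coordinates
over `K`: the entry in column `(t, j)` is `μ_j (β_i * γ_l ^ t)`. -/
noncomputable def expandedGenMatrix {K L ι : Type*} [Field K] [Field L] [Algebra K L] {m : ℕ}
    (β : Module.Basis (Fin m) K L) (N : ℕ) (γ : ι → L) :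
    Matrix (ι × Fin m) (Fin N × Fin m) K :=
  Matrix.of fun r c => β.repr (β r.2 * gVec N (γ r.1) c.1) c.2

/-- The expanded code: the row space over `K` of the expanded generator matrix. -/
noncomputable def expandedCode {K L ι : Type*} [Field K] [Field L] [Algebra K L] {m : ℕ}
    (β : Module.Basis (Fin m) K L) (N : ℕ) (γ : ι → L) : Submodule K (Fin N × Fin m → K) :=
  Submodule.span K (Set.range (expandedGenMatrix β N γ).row)

/-- A word is represented by the subbasis `{β_j : j ∈ S}` if its components with respect to all
other basis elements vanish. -/
def RepresentedBySubbasis {K : Type*} [Field K] {N m : ℕ} (S : Finset (Fin m))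
    (c : Fin N × Fin m → K) : Prop :=
  ∀ j, j ∉ S → ∀ t, c (t, j) = 0

/-- Some nonzero codeword of the expanded code of the family `γ` is represented by a subbasis
with at most `i` elements. -/
def HasSubbasisCodeword {K L ι : Type*} [Field K] [Field L] [Algebra K L] {m : ℕ}
    (β : Module.Basis (Fin m) K L) (N : ℕ) (γ : ι → L) (i : ℕ) : Prop :=
  ∃ c ∈ expandedCode β N γ, c ≠ 0 ∧
    ∃ S : Finset (Fin m), S.card ≤ i ∧ RepresentedBySubbasis S c

/-- The polynomial `(x^N - 1) / LCM {p_{γ_l⁻¹} : l}`, where `l` runs over those indices for which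
the expanded code of the part `φ(γ_l) ∩ {γ_1, …, γ_k}` has a nonzero codeword on a subbasis with
at most `i` elements. -/
noncomputable def subbasisGenPoly {K L : Type*} [Field K] [Fintype K] [Field L] [Algebra K L]
    {m k : ℕ} (β : Module.Basis (Fin m) K L) (N : ℕ) (γ : Fin k → L) (i : ℕ) : K[X] :=
  open Classical in
  (X ^ N - 1) /
    (Finset.univ.filter fun l : Fin k =>
      HasSubbasisCodeword β N
        (fun x : ↥(conjClass K (γ l) ∩ Set.range γ) => (x : L)) i).lcm
      fun l => minpoly K (γ l)⁻¹

/-- The cyclic code of length `N` with generator polynomial `G` (a divisor of `x^N - 1`): the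
words `c` for which `G` divides `c_0 + c_1 x + ⋯ + c_{N-1} x^(N-1)`. -/
def cyclicCode {K : Type*} [Field K] (N : ℕ) (G : K[X]) : Set (Fin N → K) :=
  {c | G ∣ ∑ t : Fin N, C (c t) * X ^ (t : ℕ)}

/-! ### Spectra of words over `K` at nonzero elements of `L` -/

section Spectrum

variable {K L : Type*} [Field K] [Field L] [Algebra K L]

/-! The component words of a codeword are `f (a γ^t)` summed over the `γ_l`, with `f` a coordinate
functional. For `x^N = γ^N = 1`, `F(a) = powSpectrum N f x γ a` satisfies `x F(aγ) = F(a)`, so by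
`K`-linearity `F(a P(γ)) = P(x⁻¹) F(a)`. Taking `P = minpoly K γ` kills `F` unless `x⁻¹` is
conjugate to `γ`. Thus spectra split by conjugacy class: each class part of a codeword supported on
a subbasis `S` again vanishes off `S`. Let `S` index the nonzero components and `i = |S|`. A nonzero
spectral value at `x` gives a nonzero class part on `S`, hence some `l ∈ J_i` with `x` a root of
`p_{γ_l⁻¹}`. So the LCM times a component vanishes on all of `L \ {0}`, and `G^(i)` divides the
component. Each of the `i` nonzero components then has weight at least `d^(i)`. -/

/-- The polynomial `u_0 + u_1 x + ⋯ + u_{N-1} x^(N-1)` of a word `u`. -/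
noncomputable def wordPoly {N : ℕ} (u : Fin N → K) : K[X] :=
  ∑ t : Fin N, C (u t) * X ^ (t : ℕ)

theorem aeval_wordPoly {N : ℕ} (u : Fin N → K) (x : L) :
    aeval x (wordPoly u) = ∑ t : Fin N, algebraMap K L (u t) * x ^ (t : ℕ) := by
  simp [wordPoly]

theorem coeff_wordPoly {N : ℕ} (u : Fin N → K) (t : Fin N) : (wordPoly u).coeff t = u t := by
  simp [wordPoly, coeff_C_mul, coeff_X_pow, Fin.val_inj]

theorem degree_wordPoly_lt {N : ℕ} (u : Fin N → K) : (wordPoly u).degree < N := by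
  refine (degree_sum_le _ _).trans_lt ?_
  refine (Finset.sup_lt_iff (WithBot.bot_lt_coe N)).2 fun t _ => ?_
  exact (degree_C_mul_X_pow_le _ _).trans_lt (Nat.cast_lt.2 t.2)

/-- The discrete Fourier transform at `x` of the word `(f (a γ^t))_t`. -/
def powSpectrum (N : ℕ) (f : L →ₗ[K] L) (x γ a : L) : L :=
  ∑ t ∈ Finset.range N, f (a * γ ^ t) * x ^ t

theorem mul_powSpectrum {N : ℕ} (f : L →ₗ[K] L) {x γ : L} (hx : x ^ N = 1) (hγ : γ ^ N = 1)
    (a : L) : x * powSpectrum N f x γ (a * γ) = powSpectrum N f x γ a := by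
  -- Cyclic shift: the terms `t = 0` and `t = N` of the sum over `range (N + 1)` agree, so dropping
  -- either gives the same sum.
  have h := Finset.sum_range_succ' (fun t => f (a * γ ^ t) * x ^ t) N
  rw [Finset.sum_range_succ] at h
  simp only [hx, hγ, pow_zero, mul_one] at h
  unfold powSpectrum
  rw [add_right_cancel h, Finset.mul_sum]
  refine Finset.sum_congr rfl fun t _ => ?_
  rw [pow_succ', pow_succ', ← mul_assoc a]
  ring

theorem powSpectrum_mul_aeval {N : ℕ} (f : L →ₗ[K] L) {x γ : L} (hx : x ^ N = 1)
    (hγ : γ ^ N = 1) (hx0 : x ≠ 0) (a : L) (P : K[X]) :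
    powSpectrum N f x γ (a * aeval γ P) = aeval x⁻¹ P * powSpectrum N f x γ a := by
  induction P using Polynomial.induction_on generalizing a with
  | C r =>
    simp only [powSpectrum, aeval_C, Finset.mul_sum]
    refine Finset.sum_congr rfl fun t _ => ?_
    rw [mul_comm a, mul_assoc, ← Algebra.smul_def, map_smul, Algebra.smul_def, mul_assoc]
  | add P Q hP hQ =>
    rw [map_add, map_add, add_mul, ← hP, ← hQ]
    simp [powSpectrum, mul_add, add_mul, Finset.sum_add_distrib]
  | monomial n r h =>
    have h1 : ∀ y : L, aeval y (C r * X ^ (n + 1)) = aeval y (C r * X ^ n) * y := fun y => by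
      simp [pow_succ, mul_assoc]
    rw [h1, h1, ← mul_assoc, mul_comm _ x⁻¹, mul_assoc x⁻¹, ← h,
      ← mul_powSpectrum f hx hγ (a * _), inv_mul_cancel_left₀ hx0]

theorem powSpectrum_eq_zero {N : ℕ} (f : L →ₗ[K] L) {x γ : L} (hx : x ^ N = 1)
    (hγ : γ ^ N = 1) (hx0 : x ≠ 0) (h : aeval x⁻¹ (minpoly K γ) ≠ 0) (a : L) :
    powSpectrum N f x γ a = 0 := by
  have := powSpectrum_mul_aeval f hx hγ hx0 a (minpoly K γ)
  rw [minpoly.aeval, mul_zero] at this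
  exact (mul_eq_zero.1 (this.symm.trans (by simp [powSpectrum]))).resolve_left h

end Spectrum

/-! ### Vanishing on nonzero elements, and conjugacy via Frobenius -/

section FiniteFields

variable {K L : Type*} [Field K] [Field L] [Algebra K L]

/-- There are `N` nonzero points in `L`, more than the degree allows as roots. -/
theorem eq_zero_of_aeval_eq_zero_of_degree_lt [Fintype L] {N : ℕ} (hN : N = Fintype.card L - 1) {P : K[X]}
    (hdeg : P.degree < N) (h : ∀ x : L, x ≠ 0 → aeval x P = 0) : P = 0 := by
  classical
  have h0 : P.map (algebraMap K L) = 0 := by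
    refine eq_zero_of_degree_lt_of_eval_finset_eq_zero (Finset.univ.erase (0 : L)) ?_ ?_
    · rwa [degree_map, Finset.card_erase_of_mem (Finset.mem_univ _), Finset.card_univ, ← hN]
    · intro x hx
      rw [eval_map_algebraMap]
      exact h x (Finset.ne_of_mem_erase hx)
  exact (Polynomial.map_eq_zero _).1 h0

theorem X_pow_sub_one_dvd_of_aeval_eq_zero [Fintype L] {N : ℕ} (hN : N = Fintype.card L - 1) {P : K[X]}
    (h : ∀ x : L, x ≠ 0 → aeval x P = 0) : X ^ N - 1 ∣ P := by
  have hN0 : 0 < N := by have := Fintype.one_lt_card (α := L); omega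
  have hm : (X ^ N - 1 : K[X]).Monic := monic_X_pow_sub_C 1 hN0.ne'
  rw [← modByMonic_eq_zero_iff_dvd hm]
  refine eq_zero_of_aeval_eq_zero_of_degree_lt (L := L) hN ?_ fun x hx => ?_
  · have := degree_modByMonic_lt P hm
    rwa [← C_1, degree_X_pow_sub_C hN0, C_1] at this
  · have hxN : x ^ N = 1 := hN ▸ FiniteField.pow_card_sub_one_eq_one x hx
    rw [modByMonic_eq_sub_mul_div]
    simp [h x hx, hxN]

theorem minpoly_eq_of_mem_conjClass [Fintype K] {x y : L} (h : y ∈ conjClass K x) :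
    minpoly K y = minpoly K x := by
  obtain ⟨s, rfl⟩ := h
  have := minpoly.algHom_eq ((FiniteField.frobeniusAlgHom K L) ^ s)
    (RingHom.injective ((FiniteField.frobeniusAlgHom K L ^ s : L →ₐ[K] L) : L →+* L)) x
  rw [← this]
  congr 1
  simp [FiniteField.coe_frobeniusAlgHom, AlgHom.coe_pow, pow_iterate]

/-- Roots of one minimal polynomial are Galois conjugate, and the Galois group consists of powers of
Frobenius. -/
theorem mem_conjClass_of_aeval_minpoly_eq_zero [Fintype K] [Finite L] {x y : L} (h : aeval y (minpoly K x) = 0) :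
    y ∈ conjClass K x := by
  obtain ⟨σ, rfl⟩ := minpoly.exists_algEquiv_of_root'
    (Algebra.IsAlgebraic.isAlgebraic (R := K) x) h
  obtain ⟨s, rfl⟩ := (FiniteField.bijective_frobeniusAlgEquivOfAlgebraic_pow K L).2 σ
  refine ⟨s, ?_⟩
  simp [AlgEquiv.coe_pow, FiniteField.coe_frobeniusAlgEquivOfAlgebraic_iterate]

theorem aeval_minpoly_eq_zero_iff [Fintype K] [Finite L] {x y : L} :
    aeval y (minpoly K x) = 0 ↔ y ∈ conjClass K x :=
  ⟨mem_conjClass_of_aeval_minpoly_eq_zero, fun h => by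
    rw [← minpoly_eq_of_mem_conjClass h, minpoly.aeval]⟩

end FiniteFields

theorem inv_mem_conjClass_inv {K L : Type*} [Fintype K] [Field L] {x y : L}
    (h : y ∈ conjClass K x) : y⁻¹ ∈ conjClass K x⁻¹ := by
  obtain ⟨s, rfl⟩ := h
  exact ⟨s, by simp⟩

/-! ### Expanded codes -/

section ExpandedCode

variable {K L ι : Type*} [Field K] [Field L] [Algebra K L] {m : ℕ}

/-- The word of `K`-coordinates of `a [1, γ, …, γ^(N-1)]`. -/
noncomputable def coordWord (β : Module.Basis (Fin m) K L) (N : ℕ) (γ a : L) :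
    Fin N × Fin m → K :=
  fun c => β.repr (a * γ ^ (c.1 : ℕ)) c.2

/-- The rows `β_i g(γ_l)` give all multiples `a g(γ_l)`, since the `β_i` span `L` over `K`. -/
theorem coordWord_mem_expandedCode (β : Module.Basis (Fin m) K L) (N : ℕ) (γ : ι → L) (l : ι)
    (a : L) : coordWord β N (γ l) a ∈ expandedCode β N γ := by
  have h : coordWord β N (γ l) a =
      ∑ i, β.repr a i • (expandedGenMatrix β N γ).row (l, i) := by
    ext c
    conv_lhs => rw [coordWord, ← β.sum_repr a, Finset.sum_mul, map_sum]
    simp [expandedGenMatrix, gVec]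
  rw [h]
  exact Submodule.sum_mem _ fun i _ =>
    Submodule.smul_mem _ _ (Submodule.subset_span ⟨_, rfl⟩)

theorem exists_sum_coordWord_of_mem [Fintype ι] (β : Module.Basis (Fin m) K L) (N : ℕ)
    (γ : ι → L) {c : Fin N × Fin m → K} (hc : c ∈ expandedCode β N γ) :
    ∃ a : ι → L, c = ∑ l, coordWord β N (γ l) (a l) := by
  obtain ⟨w, rfl⟩ := (Submodule.mem_span_range_iff_exists_fun K).1 hc
  refine ⟨fun l => ∑ i, w (l, i) • β i, ?_⟩
  rw [Fintype.sum_prod_type]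
  refine Finset.sum_congr rfl fun l _ => ?_
  ext c
  rw [coordWord, Finset.sum_mul, map_sum]
  simp [expandedGenMatrix, gVec]

/-- The words of the components with respect to the `j`-th basis element. -/
def component {N : ℕ} (c : Fin N × Fin m → K) (j : Fin m) : Fin N → K := fun t => c (t, j)

theorem aeval_wordPoly_component_sum (β : Module.Basis (Fin m) K L) (N : ℕ) (γ a : ι → L)
    (s : Finset ι) (j : Fin m) (x : L) :
    aeval x (wordPoly (component (∑ l ∈ s, coordWord β N (γ l) (a l)) j)) =
      ∑ l ∈ s, powSpectrum N (Algebra.linearMap K L ∘ₗ β.coord j) x (γ l) (a l) := by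
  simp only [aeval_wordPoly, component, Finset.sum_apply, map_sum, Finset.sum_mul, powSpectrum,
    ← Fin.sum_univ_eq_sum_range]
  rw [Finset.sum_comm]
  rfl

open Classical in
theorem hammingNorm_eq_sum_component {N : ℕ} (c : Fin N × Fin m → K) :
    hammingNorm c = ∑ j, hammingNorm (component c j) := by
  simp only [hammingNorm, Finset.card_filter]
  rw [Fintype.sum_prod_type_right]
  rfl

open Classical in
theorem minDist_le_hammingNorm {κ : Type*} [Fintype κ] {D : Set (κ → K)}
    (h0 : (0 : κ → K) ∈ D) {u : κ → K} (hu : u ∈ D) (hu0 : u ≠ 0) :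
    minDist D ≤ (hammingNorm u : ℕ∞) := by
  unfold minDist
  refine (iInf₂_le u hu).trans ((iInf₂_le 0 h0).trans ((iInf_le _ hu0).trans ?_))
  rw [hammingDist_zero_right]

open Classical in
theorem le_minDist_of_le_hammingNorm {κ : Type*} [Fintype κ]
    (D : Submodule K (κ → K)) {d : ℕ∞} (h : ∀ c ∈ D, c ≠ 0 → d ≤ (hammingNorm c : ℕ∞)) :
    d ≤ minDist (D : Set (κ → K)) := by
  unfold minDist
  refine le_iInf₂ fun x hx => le_iInf₂ fun y hy => le_iInf fun hxy => ?_
  refine (h (-x + y) (D.add_mem (D.neg_mem hx) hy)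
    fun h0 => hxy (neg_add_eq_zero.1 h0)).trans (le_of_eq ?_)
  rw [← hammingDist_eq_hammingNorm]

open Classical in
/-- If every nonzero component of `c` lies in `D`, then the weight of `c` is at least the number
of nonzero components times the minimum distance of `D`. -/
theorem card_mul_minDist_le_hammingNorm {N : ℕ} {D : Set (Fin N → K)}
    (h0 : (0 : Fin N → K) ∈ D) (c : Fin N × Fin m → K) (S : Finset (Fin m))
    (hD : ∀ j ∈ S, component c j ∈ D) (hS : ∀ j ∈ S, component c j ≠ 0) :
    (S.card : ℕ∞) * minDist D ≤ (hammingNorm c : ℕ∞) := by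
  rw [hammingNorm_eq_sum_component, Nat.cast_sum]
  refine le_trans ?_ (Finset.sum_le_sum_of_subset (Finset.subset_univ S))
  rw [← nsmul_eq_mul]
  exact Finset.card_nsmul_le_sum _ _ _ fun j hj => minDist_le_hammingNorm h0 (hD j hj) (hS j hj)

end ExpandedCode

/-! ### Components of codewords lie in cyclic codes -/

section CyclicComponents

variable {K L : Type*} [Field K] [Fintype K] [Field L] [Fintype L] [Algebra K L]
  {m k N : ℕ} (β : Module.Basis (Fin m) K L) {γ : Fin k → L}

open Classical in
/-- At a nonzero `x`, the part of `∑ₗ aₗ g(γₗ)` belonging to the conjugacy class of `y` has the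
same spectrum as the whole word if `x⁻¹` lies in that class, and vanishing spectrum otherwise. -/
theorem aeval_component_conjClass_part (hN : N = Fintype.card L - 1) (hγ : ∀ l, γ l ≠ 0)
    (a : Fin k → L) (j : Fin m) (y x : L) (hx : x ≠ 0) :
    aeval x (wordPoly (component
      (∑ l ∈ Finset.univ.filter (fun l => γ l ∈ conjClass K y),
        coordWord β N (γ l) (a l)) j)) =
      if x⁻¹ ∈ conjClass K y then
        aeval x (wordPoly (component (∑ l, coordWord β N (γ l) (a l)) j)) else 0 := by
  have hpow : ∀ z : L, z ≠ 0 → z ^ N = 1 := fun z hz =>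
    hN ▸ FiniteField.pow_card_sub_one_eq_one z hz
  have hvanish : ∀ l, minpoly K (γ l) ≠ minpoly K x⁻¹ →
      powSpectrum N (Algebra.linearMap K L ∘ₗ β.coord j) x (γ l) (a l) = 0 := fun l hl =>
    powSpectrum_eq_zero _ (hpow x hx) (hpow _ (hγ l)) hx (fun h => hl
      (minpoly_eq_of_mem_conjClass (mem_conjClass_of_aeval_minpoly_eq_zero h)).symm) _
  simp only [aeval_wordPoly_component_sum]
  split_ifs with hxy
  · refine Finset.sum_subset (Finset.subset_univ _) fun l _ hl => hvanish l fun h => hl ?_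
    rw [Finset.mem_filter, ← aeval_minpoly_eq_zero_iff, ← minpoly_eq_of_mem_conjClass hxy, ← h]
    exact ⟨Finset.mem_univ _, minpoly.aeval _ _⟩
  · refine Finset.sum_eq_zero fun l hl => hvanish l fun h => hxy ?_
    rw [← aeval_minpoly_eq_zero_iff,
      ← minpoly_eq_of_mem_conjClass (Finset.mem_filter.1 hl).2, h]
    exact minpoly.aeval _ _

/-- If the spectrum of a component of a codeword on the subbasis `S` does not vanish at `x`, then
`x⁻¹` is conjugate to some `γₗ` whose conjugacy part has a nonzero codeword on `S`. -/
theorem exists_hasSubbasisCodeword (hN : N = Fintype.card L - 1) (hγ : ∀ l, γ l ≠ 0)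
    {c : Fin N × Fin m → K} (hc : c ∈ expandedCode β N γ) {S : Finset (Fin m)}
    (hS : RepresentedBySubbasis S c) {j : Fin m} {x : L} (hx : x ≠ 0)
    (h : aeval x (wordPoly (component c j)) ≠ 0) :
    ∃ l, x⁻¹ ∈ conjClass K (γ l) ∧ HasSubbasisCodeword β N
      (fun z : ↥(conjClass K (γ l) ∩ Set.range γ) => (z : L)) S.card := by
  classical
  obtain ⟨a, rfl⟩ := exists_sum_coordWord_of_mem β N γ hc
  have hpart := aeval_component_conjClass_part (K := K) β hN hγ a
  -- Otherwise the class part of `x⁻¹` is an empty sum, yet it has the same nonzero spectrum at `x`.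
  obtain ⟨l, hl⟩ : ∃ l, γ l ∈ conjClass K x⁻¹ := by
    by_contra! hno
    have h1 := hpart j x⁻¹ x hx
    rw [if_pos ⟨0, by simp⟩, Finset.filter_false_of_mem fun l _ => hno l] at h1
    exact h (h1.symm.trans (by simp [aeval_wordPoly, component]))
  have hxl : x⁻¹ ∈ conjClass K (γ l) := by
    rw [← aeval_minpoly_eq_zero_iff, minpoly_eq_of_mem_conjClass hl]
    exact minpoly.aeval _ _
  refine ⟨l, hxl, ∑ i ∈ Finset.univ.filter (fun i => γ i ∈ conjClass K (γ l)),
    coordWord β N (γ i) (a i), Submodule.sum_mem _ fun i hi => ?_, fun h0 => ?_, S, le_rfl,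
    fun i hi t => ?_⟩
  · exact coordWord_mem_expandedCode β N
      (fun z : ↥(conjClass K (γ l) ∩ Set.range γ) => (z : L))
      ⟨γ i, (Finset.mem_filter.1 hi).2, i, rfl⟩ (a i)
  · have h1 := hpart j (γ l) x hx
    rw [if_pos hxl, h0] at h1
    exact h (h1.symm.trans (by simp [aeval_wordPoly, component]))
  -- For `i ∉ S` the spectrum of the class part is everywhere either 0 or that of the whole word's
  -- component, itself 0.
  · have hzero : wordPoly (component (∑ i ∈ Finset.univ.filter
        (fun i => γ i ∈ conjClass K (γ l)), coordWord β N (γ i) (a i)) i) = 0 := by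
      refine eq_zero_of_aeval_eq_zero_of_degree_lt (L := L) hN (degree_wordPoly_lt _)
        fun y hy => ?_
      have hi0 : component (∑ l, coordWord β N (γ l) (a l)) i = 0 := funext fun t => hS i hi t
      rw [hpart i (γ l) y hy, hi0]
      simp [aeval_wordPoly]
    have := coeff_wordPoly (component (∑ i ∈ Finset.univ.filter
        (fun i => γ i ∈ conjClass K (γ l)), coordWord β N (γ i) (a i)) i) t
    rw [hzero, coeff_zero] at this
    exact this.symm

theorem component_mem_cyclicCode (hN : N = Fintype.card L - 1) (hγ : ∀ l, γ l ≠ 0)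
    {c : Fin N × Fin m → K} (hc : c ∈ expandedCode β N γ) {S : Finset (Fin m)}
    (hS : RepresentedBySubbasis S c) (j : Fin m) :
    component c j ∈ cyclicCode N (subbasisGenPoly β N γ S.card) := by
  classical
  unfold cyclicCode subbasisGenPoly
  rw [Set.mem_ofPred_eq]
  set J := Finset.univ.filter fun l : Fin k => HasSubbasisCodeword β N
    (fun z : ↥(conjClass K (γ l) ∩ Set.range γ) => (z : L)) S.card with hJ
  set H := J.lcm fun l => minpoly K (γ l)⁻¹ with hH
  have hH0 : H ≠ 0 := by
    rw [hH, Ne, Finset.lcm_eq_zero_iff]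
    rintro ⟨l, -, hl⟩
    exact minpoly.ne_zero (Algebra.IsIntegral.isIntegral (R := K) (γ l)⁻¹) hl
  have hHdvd : H ∣ X ^ N - 1 := Finset.lcm_dvd fun l _ => minpoly.dvd _ _ (by
    have := FiniteField.pow_card_sub_one_eq_one _ (inv_ne_zero (hγ l))
    simp only [map_sub, map_pow, aeval_X, map_one, hN, this, sub_self])
  have key : X ^ N - 1 ∣ H * wordPoly (component c j) := by
    refine X_pow_sub_one_dvd_of_aeval_eq_zero (L := L) hN fun x hx => ?_
    rw [map_mul, mul_eq_zero]
    by_contra! h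
    obtain ⟨l, hl, hcode⟩ := exists_hasSubbasisCodeword β hN hγ hc hS hx h.2
    have hroot : aeval x (minpoly K (γ l)⁻¹) = 0 :=
      aeval_minpoly_eq_zero_iff.2 (by simpa using inv_mem_conjClass_inv hl)
    obtain ⟨Q, hQ⟩ : minpoly K (γ l)⁻¹ ∣ H :=
      Finset.dvd_lcm (f := fun l => minpoly K (γ l)⁻¹) (by simpa [hJ] using hcode)
    exact h.1 (by rw [hQ, map_mul, hroot, zero_mul])
  -- Write `X^N - 1` as `H` times the generator polynomial and cancel `H`.
  rw [← EuclideanDomain.mul_div_cancel' hH0 hHdvd] at key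
  exact (mul_dvd_mul_iff_left hH0).1 key

end CyclicComponents

theorem mainTheorem5 {K L : Type*} [Field K] [Fintype K] [Field L] [Algebra K L]
    (m k : ℕ) (β : Module.Basis (Fin m) K L)
    (γ : Fin k → L) (hγ : ∀ l, γ l ≠ 0)
    (N : ℕ) (hN : N = Fintype.card K ^ m - 1) :
    (⨅ i ∈ Finset.Icc 1 m, (i : ℕ∞) * minDist (cyclicCode N (subbasisGenPoly β N γ i))) ≤
      minDist (expandedCode β N γ : Set (Fin N × Fin m → K)) := by
  classical
  let _ : Fintype L := Fintype.ofEquiv _ β.equivFun.toEquiv.symm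
  have hNL : N = Fintype.card L - 1 := by
    rw [hN, Fintype.card_congr β.equivFun.toEquiv]
    simp
  refine le_minDist_of_le_hammingNorm _ fun c hc hc0 => ?_
  set S : Finset (Fin m) := Finset.univ.filter fun j => component c j ≠ 0 with hSdef
  have hS : RepresentedBySubbasis S c := fun j hj t => by
    have : component c j = 0 := by simpa [hSdef] using hj
    exact congrFun this t
  have hS1 : 1 ≤ S.card := by
    rw [Finset.one_le_card]
    by_contra hne
    rw [Finset.not_nonempty_iff_eq_empty] at hne
    exact hc0 (funext fun ⟨t, j⟩ => hS j (by simp [hne]) t)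
  have hSm : S.card ≤ m := (Finset.card_le_univ S).trans_eq (Fintype.card_fin m)
  -- The term of the minimum to use is the number of nonzero components.
  refine (iInf₂_le S.card (Finset.mem_Icc.2 ⟨hS1, hSm⟩)).trans ?_
  refine card_mul_minDist_le_hammingNorm ?_ c S
    (fun j _ => component_mem_cyclicCode β hNL hγ hc hS j) fun j hj => (Finset.mem_filter.1 hj).2
  simp [cyclicCode]
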